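/- Let $d,n,t\ge 0$ be integers with $n>2t$. For a finite nonempty family of vectors in $\mathbb{R}^d$ (Euclidean norm), its minimum enclosing ball (MEB) is the unique closed ball of smallest radius containing it. For $v=(v_1,\dots,v_n)\in(\mathbb{R}^d)^n$ and a nonempty $T\subseteq\{1,\dots,n\}$ let $c_T$ and $r_T$ be the centre and the radius of the MEB of $(v_i)_{i\in T}$. An aggregation rule $A:(\mathbb{R}^d)^n\to\mathbb{R}^d$ satisfies *$c$-MEB validity* if for every $v$ and every $H\subseteq\{1,\dots,n\}$ with $|H|\ge n-t$ (the possible sets of honest nodes) one has $\|A(v)-c_H\|\le c\,r_H$. Let $c^*$ be the infimum of all $c\ge 0$ for which some aggregation rule satisfies $c$-MEB validity (the optimal relaxation factor). The rule *MinMax-MEB* returns, on input $v$, the centre $c_T$ of some $T$ with $|T|=n-t$ and $r_T=0$ if there is such a $T$, and otherwise a point $y^*$ minimizing $$y\mapsto\max_{|T|=n-t}\frac{\max\{0,\|y-c_T\|-r_T\}}{r_T}$$ over $y\in\mathbb{R}^d$ (choices among several such $T$ or several minimizers are arbitrary). **Theorem.** Let $k=\min\{d,\binom{n}{n-t}-1\}$.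 The infimum $c^*$ is attained, and $$c^*\le 1+\frac{k-1}{k+1+\sqrt{2(k+1)k}}<\sqrt2 .$$ Moreover, MinMax-MEB is well defined (the required minimizers exist); however its choices are made, it satisfies $\max\{1,c^*\}$-MEB validity, and if $t\ge 1$ it satisfies $c^*$-MEB validity, i.e. it achieves the optimal factor. -/

import Mathlib

/-- The ball with centre `z` and radius `r` is a minimum enclosing ball of `S`: it contains `S`, and
no closed ball containing `S` has smaller radius. -/
def IsMEB {d : ℕ} (S : Set (EuclideanSpace ℝ (Fin d))) (z : EuclideanSpace ℝ (Fin d)) (r : ℝ) :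
    Prop :=
  S ⊆ Metric.closedBall z r ∧
    ∀ (z' : EuclideanSpace ℝ (Fin d)) (r' : ℝ), S ⊆ Metric.closedBall z' r' → r ≤ r'

/-- Every nonempty finite set has a minimum enclosing ball. -/
theorem exists_isMEB {d : ℕ} {S : Set (EuclideanSpace ℝ (Fin d))} (hfin : S.Finite)
    (hne : S.Nonempty) : ∃ p : EuclideanSpace ℝ (Fin d) × ℝ, IsMEB S p.1 p.2 := by
  obtain ⟨p₀, hp₀⟩ := hne
  have hF : hfin.toFinset.Nonempty := ⟨p₀, by simpa using hp₀⟩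
  let f : EuclideanSpace ℝ (Fin d) → ℝ := fun z => hfin.toFinset.sup' hF (fun p => dist p z)
  have hcont : Continuous f :=
    Continuous.finset_sup'_apply hF (fun p _ => by fun_prop)
  have hle : ∀ z, dist p₀ z ≤ f z := fun z =>
    Finset.le_sup' (fun p => dist p z) (by simpa using hp₀)
  have htend : Filter.Tendsto f (Filter.cocompact _) Filter.atTop :=
    Filter.tendsto_atTop_mono hle (tendsto_dist_left_cocompact_atTop p₀)
  obtain ⟨z, hz⟩ := hcont.exists_forall_le htend
  refine ⟨(z, f z), fun p hp => ?_, fun z' r' h => ?_⟩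
  · exact Finset.le_sup' (fun p => dist p z) (by simpa using hp)
  · exact (hz z').trans (Finset.sup'_le _ _ (fun p hp => h (by simpa using hp)))

/-- The minimum enclosing ball of a nonempty set is unique. -/
theorem IsMEB.unique {d : ℕ} {S : Set (EuclideanSpace ℝ (Fin d))} (hne : S.Nonempty)
    {z₁ z₂ : EuclideanSpace ℝ (Fin d)} {r₁ r₂ : ℝ} (h₁ : IsMEB S z₁ r₁) (h₂ : IsMEB S z₂ r₂) :
    z₁ = z₂ ∧ r₁ = r₂ := by
  have hr : r₁ = r₂ := le_antisymm (h₁.2 _ _ h₂.1) (h₂.2 _ _ h₁.1)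
  subst hr
  refine ⟨?_, rfl⟩
  by_contra hz
  obtain ⟨p₀, hp₀⟩ := hne
  have hr0 : 0 ≤ r₁ := dist_nonneg.trans (h₁.1 hp₀)
  have hpos : 0 < ‖z₁ - z₂‖ := norm_pos_iff.mpr (sub_ne_zero.mpr hz)
  have key : ∀ p ∈ S, dist p (midpoint ℝ z₁ z₂) ^ 2 ≤ r₁ ^ 2 - ‖z₁ - z₂‖ ^ 2 / 4 := by
    intro p hp
    have a1 : ‖p - z₁‖ ≤ r₁ := by simpa [dist_eq_norm] using h₁.1 hp
    have a2 : ‖p - z₂‖ ≤ r₁ := by simpa [dist_eq_norm] using h₂.1 hp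
    have par := parallelogram_law_with_norm ℝ (p - z₁) (p - z₂)
    have e1 : (p - z₁) + (p - z₂) = (2 : ℝ) • (p - midpoint ℝ z₁ z₂) := by
      rw [midpoint_eq_smul_add, smul_sub, smul_smul]
      norm_num
      rw [two_smul]
      abel
    have e2 : (p - z₁) - (p - z₂) = -(z₁ - z₂) := by abel
    rw [e1, e2, norm_neg, norm_smul] at par
    norm_num at par
    rw [dist_eq_norm]
    nlinarith [norm_nonneg (p - z₁), norm_nonneg (p - z₂)]
  have hmin := h₁.2 (midpoint ℝ z₁ z₂) (Real.sqrt (r₁ ^ 2 - ‖z₁ - z₂‖ ^ 2 / 4))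
    (fun p hp => Real.le_sqrt_of_sq_le (key p hp))
  have hnn : 0 ≤ r₁ ^ 2 - ‖z₁ - z₂‖ ^ 2 / 4 := (sq_nonneg _).trans (key p₀ hp₀)
  have := Real.sq_sqrt hnn
  nlinarith [Real.sqrt_nonneg (r₁ ^ 2 - ‖z₁ - z₂‖ ^ 2 / 4)]

open Classical in
/-- Centre and radius of the minimum enclosing ball of `S`
(with the value `(0, 0)` if `S` has no minimum enclosing ball, e.g. if `S` is empty). -/
noncomputable def meb {d : ℕ} (S : Set (EuclideanSpace ℝ (Fin d))) :
    EuclideanSpace ℝ (Fin d) × ℝ :=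
  if h : ∃ p : EuclideanSpace ℝ (Fin d) × ℝ, IsMEB S p.1 p.2 then h.choose else (0, 0)

/-- Centre of the minimum enclosing ball of the vectors `v i`, `i ∈ T`. -/
noncomputable def mebCenter {d n : ℕ} (v : Fin n → EuclideanSpace ℝ (Fin d)) (T : Finset (Fin n)) :
    EuclideanSpace ℝ (Fin d) :=
  (meb (v '' (T : Set (Fin n)))).1

/-- Radius of the minimum enclosing ball of the vectors `v i`, `i ∈ T`. -/
noncomputable def mebRadius {d n : ℕ} (v : Fin n → EuclideanSpace ℝ (Fin d)) (T : Finset (Fin n)) :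
    ℝ :=
  (meb (v '' (T : Set (Fin n)))).2

/-- `mebCenter` and `mebRadius` do describe the minimum enclosing ball. -/
theorem isMEB_mebCenter_mebRadius {d n : ℕ} (v : Fin n → EuclideanSpace ℝ (Fin d))
    {T : Finset (Fin n)} (hT : T.Nonempty) :
    IsMEB (v '' (T : Set (Fin n))) (mebCenter v T) (mebRadius v T) := by
  have h := exists_isMEB (T.finite_toSet.image v) ((Finset.coe_nonempty.mpr hT).image v)
  unfold mebCenter mebRadius meb
  rw [dif_pos h]
  exact h.choose_spec

/-- The aggregation rule `A`, which maps the `n` collected vectors to one output vector, satisfies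
`c`-MEB validity against up to `t` Byzantine nodes. The set `H` of honest nodes is any set of at
least `n - t` nodes; the entries of `v` outside `H` are chosen by the adversary. -/
def IsMEBValid {d n : ℕ} (t : ℕ) (c : ℝ)
    (A : (Fin n → EuclideanSpace ℝ (Fin d)) → EuclideanSpace ℝ (Fin d)) : Prop :=
  ∀ (v : Fin n → EuclideanSpace ℝ (Fin d)) (H : Finset (Fin n)), n - t ≤ H.card →
    ‖A v - mebCenter v H‖ ≤ c * mebRadius v H

/-- The relaxation factors `c ≥ 0` for which some aggregation rule satisfies `c`-MEB validity. -/
def achievableFactors (d n t : ℕ) : Set ℝ :=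
  {c : ℝ | 0 ≤ c ∧
    ∃ A : (Fin n → EuclideanSpace ℝ (Fin d)) → EuclideanSpace ℝ (Fin d), IsMEBValid t c A}

/-- The optimal relaxation factor. -/
noncomputable def optimalFactor (d n t : ℕ) : ℝ := sInf (achievableFactors d n t)

/-- Distance of `y` to the minimum enclosing ball of `T`, relative to the radius of that ball. -/
noncomputable def relExcess {d n : ℕ} (v : Fin n → EuclideanSpace ℝ (Fin d)) (T : Finset (Fin n))
    (y : EuclideanSpace ℝ (Fin d)) : ℝ :=
  max 0 (‖y - mebCenter v T‖ - mebRadius v T) / mebRadius v T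

/-- The objective of MinMax-MEB: the maximum of `relExcess` over all `T` with exactly `n - t`
elements (a maximum over a finite nonempty family). -/
noncomputable def maxRelExcess {d n : ℕ} (t : ℕ) (v : Fin n → EuclideanSpace ℝ (Fin d))
    (y : EuclideanSpace ℝ (Fin d)) : ℝ :=
  ⨆ T : {T : Finset (Fin n) // T.card = n - t}, relExcess v T.1 y

/-- `A` is an instance of the rule MinMax-MEB, for some way of making its choices: if some `T` with
`n - t` elements has a minimum enclosing ball of radius `0`, then the output is the centre of such a
ball; otherwise the output is a minimizer of `maxRelExcess`. -/
def IsMinMaxMEB {d n : ℕ} (t : ℕ)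
    (A : (Fin n → EuclideanSpace ℝ (Fin d)) → EuclideanSpace ℝ (Fin d)) : Prop :=
  ∀ v : Fin n → EuclideanSpace ℝ (Fin d),
    ((∃ T : Finset (Fin n), T.card = n - t ∧ mebRadius v T = 0) →
      ∃ T : Finset (Fin n), T.card = n - t ∧ mebRadius v T = 0 ∧ A v = mebCenter v T) ∧
    ((¬ ∃ T : Finset (Fin n), T.card = n - t ∧ mebRadius v T = 0) →
      ∀ y : EuclideanSpace ℝ (Fin d), maxRelExcess t v (A v) ≤ maxRelExcess t v y)

/-- `k = min {d, C(n, n - t) - 1}`. -/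
def effDim (d n t : ℕ) : ℕ := min d (n.choose (n - t) - 1)

/-- The bound `1 + (k - 1) / (k + 1 + √(2 (k + 1) k))`. -/
noncomputable def soddyBound (k : ℕ) : ℝ :=
  1 + ((k : ℝ) - 1) / ((k : ℝ) + 1 + Real.sqrt (2 * ((k : ℝ) + 1) * (k : ℝ)))

/-! A rule may treat each input separately, so `c` is achievable as soon as, for every `v`, the
balls about `c_T` of radius `c * r_T` have a common point. Only `|T| = n - t` matters: from a larger
`H` some `i` can be dropped so that the centre does not move towards the output, while the radius
does not grow; hence the bound passes from `H.erase i` to `H` (`norm_sub_mebCenter_le_of_card_le`).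

As `n > 2t`, two sets of size `n - t` share an index, so their balls meet. At the least common
scaling `l` with a common point, that point is a convex combination of active centres, at most `k +
1` of them by Carathéodory; expanding its squared norm and applying Cauchy–Schwarz yields a weighted
Jung bound `l ^ 2 ≤ 2k / (k + 1)`, the square of `soddyBound k`. Compactness shows that the infimum
is attained.

For `c ≥ 1` and positive radii, validity at `T` says `relExcess ≤ c - 1`, so a minimizer does as
well as any rule; a zero radius forces the output. Factors below `1` are invisible to the objective,
but two touching balls exclude them when `t, d ≥ 1`. -/

/-! ### Convex geometry: active centres, cones, and a weighted Jung theorem. -/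

section Geometry

variable {E : Type*} [NormedAddCommGroup E] [InnerProductSpace ℝ E]

open scoped RealInnerProductSpace

/-- Moving slightly from `y` in a direction making a positive inner product with `p - y` brings the
point closer to `p`. -/
theorem eventually_dist_add_smul_lt {y u p : E} {R : ℝ} (hR : dist y p ≤ R)
    (hu : dist y p = R → 0 < ⟪u, p - y⟫) :
    ∀ᶠ ε : ℝ in nhdsWithin 0 (Set.Ioi 0), dist (y + ε • u) p < R := by
  rcases hR.lt_or_eq with h | h
  · have hc : Continuous fun ε : ℝ => dist (y + ε • u) p := by fun_prop
    have := hc.continuousAt.eventually_lt (x₀ := (0 : ℝ)) (continuousAt_const (y := R))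
      (by simpa using h)
    exact this.filter_mono nhdsWithin_le_nhds
  · have hpos := hu h
    have hc : Continuous fun ε : ℝ => ε * ‖u‖ ^ 2 := by fun_prop
    have := hc.continuousAt.eventually_lt (x₀ := (0 : ℝ))
      (continuousAt_const (y := 2 * ⟪u, p - y⟫)) (by simpa using hpos)
    filter_upwards [this.filter_mono nhdsWithin_le_nhds, self_mem_nhdsWithin] with ε h1 h2
    have h2 : 0 < ε := h2
    have e : ‖y + ε • u - p‖ ^ 2 = ‖y - p‖ ^ 2 - ε * (2 * ⟪u, p - y⟫ - ε * ‖u‖ ^ 2) := by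
      have : y + ε • u - p = (y - p) + ε • u := by abel
      rw [this, norm_add_sq_real, norm_smul, inner_smul_right, real_inner_comm,
        ← neg_sub p y, inner_neg_right, Real.norm_eq_abs, mul_pow, sq_abs, norm_neg]
      ring
    rw [← h, dist_eq_norm, dist_eq_norm]
    refine lt_of_pow_lt_pow_left₀ 2 (norm_nonneg _) ?_
    rw [e]
    nlinarith [mul_pos h2 (sub_pos.mpr h1)]

/-- If no point is strictly closer to all the `p i` than the radii `R i`, while `y` is within
distance `R i` of each of them, then `y` is a convex combination of the `p i` at distance
exactly `R i`. -/
theorem mem_convexHull_active [CompleteSpace E] {ι : Type*} (s : Finset ι) (p : ι → E)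
    (R : ι → ℝ) (y : E) (h : ∀ i ∈ s, dist y (p i) ≤ R i)
    (hmin : ∀ y', ∃ i ∈ s, R i ≤ dist y' (p i)) :
    y ∈ convexHull ℝ (p '' {i | i ∈ s ∧ dist y (p i) = R i}) := by
  by_contra hy
  have hfin : (p '' {i | i ∈ s ∧ dist y (p i) = R i}).Finite :=
    (s.finite_toSet.subset fun i hi => hi.1).image p
  obtain ⟨f, a, hfy, hf⟩ := geometric_hahn_banach_point_closed (convex_convexHull ℝ _)
    (hfin.isClosed_convexHull ℝ) hy
  -- A small move along the separating direction brings `y` closer to all active centres and keeps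
  -- the slack at the others, contradicting `hmin`.
  set u : E := (InnerProductSpace.toDual ℝ E).symm f with hu
  have huf : ∀ x, ⟪u, x⟫ = f x := fun x => InnerProductSpace.toDual_symm_apply
  have key : ∀ᶠ ε : ℝ in nhdsWithin 0 (Set.Ioi 0), ∀ i ∈ s, dist (y + ε • u) (p i) < R i := by
    rw [Filter.eventually_all_finset]
    intro i hi
    refine eventually_dist_add_smul_lt (h i hi) fun hi' => ?_
    rw [huf, map_sub]
    linarith [hf (p i) (subset_convexHull ℝ _ ⟨i, ⟨hi, hi'⟩, rfl⟩)]
  obtain ⟨ε, hε⟩ := key.exists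
  obtain ⟨i, hi, hi'⟩ := hmin (y + ε • u)
  exact absurd (hε i hi) (not_lt.mpr hi')

/-- A point of a convex hull does not lie strictly on one side of all the generators. -/
theorem exists_inner_sub_nonpos {s : Set E} {z : E} (hz : z ∈ convexHull ℝ s) (u : E) :
    ∃ p ∈ s, ⟪u, p - z⟫ ≤ 0 := by
  by_contra! hcon
  have hconv : Convex ℝ {x : E | ⟪u, z⟫ < ⟪u, x⟫} :=
    convex_halfSpace_gt (innerₛₗ ℝ u).isLinear _
  have hsub : s ⊆ {x : E | ⟪u, z⟫ < ⟪u, x⟫} := fun p hp => by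
    have := hcon p hp
    rw [inner_sub_right] at this
    simpa using this
  exact lt_irrefl ⟪u, z⟫ (convexHull_min hsub hconv hz)

/-- If `0` is a positive combination of the `p k`, then the projection of `-y` to their span lies
in the cone generated by all but one of them. -/
theorem exists_cone_facet {κ : Type*} [Fintype κ] [Nonempty κ] (p : κ → E) (w : κ → ℝ)
    (hw : ∀ k, 0 < w k) (h0 : ∑ k, w k • p k = 0) (y : E) :
    ∃ k₀ : κ, ∃ a : κ → ℝ, (∀ k, 0 ≤ a k) ∧ a k₀ = 0 ∧
      ∀ x ∈ Submodule.span ℝ (Set.range p), ⟪y, x⟫ = -∑ k, a k * ⟪p k, x⟫ := by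
  set K := Submodule.span ℝ (Set.range p) with hK
  have : FiniteDimensional ℝ K := FiniteDimensional.span_of_finite ℝ (Set.finite_range p)
  obtain ⟨b, hb⟩ := (Submodule.mem_span_range_iff_exists_fun ℝ).1
    (Submodule.starProjection_apply_mem K (-y))
  -- Subtracting the multiple `b k₀ / w k₀` of the relation `h0` kills the coefficient at `k₀`;
  -- minimality of the ratio keeps the others nonnegative.
  obtain ⟨k₀, hk₀⟩ := Finite.exists_min fun k => b k / w k
  refine ⟨k₀, fun k => b k - b k₀ / w k₀ * w k, fun k => ?_, ?_, fun x hx => ?_⟩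
  · have := (le_div_iff₀ (hw k)).1 (hk₀ k)
    linarith
  · have := (hw k₀).ne'
    field_simp
    ring
  · have h1 := Submodule.starProjection_inner_eq_zero (K := K) (-y) x hx
    rw [inner_sub_left, inner_neg_left, ← hb, sum_inner] at h1
    have h2 : ∑ k, w k * ⟪p k, x⟫ = 0 := by
      have := congrArg (fun q => ⟪q, x⟫) h0
      simpa [sum_inner, inner_smul_left] using this
    simp only [inner_smul_left, conj_trivial] at h1
    have h3 : ∑ k, (b k - b k₀ / w k₀ * w k) * ⟪p k, x⟫
        = ∑ k, b k * ⟪p k, x⟫ - b k₀ / w k₀ * ∑ k, w k * ⟪p k, x⟫ := by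
      rw [Finset.mul_sum, ← Finset.sum_sub_distrib]
      exact Finset.sum_congr rfl fun k _ => by ring
    rw [h3, h2]
    linarith

/-- The weighted Jung inequality: if the origin is a positive combination of at most `k + 1`
vectors of norms `l * r i`, and the balls of radii `r i` around them meet pairwise, then
`l ≤ √(2 k / (k + 1))`. -/
theorem le_sqrt_of_sum_smul_eq_zero {κ : Type*} [Fintype κ] [Nonempty κ] (p : κ → E)
    (w r : κ → ℝ) (hw : ∀ i, 0 < w i) (hr : ∀ i, 0 < r i) (h0 : ∑ i, w i • p i = 0) {l : ℝ}
    (hl : ∀ i, ‖p i‖ = l * r i) (hp : ∀ i j, ‖p i - p j‖ ≤ r i + r j) {k : ℕ} (hk : 1 ≤ k)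
    (hcard : Fintype.card κ ≤ k + 1) : l ≤ Real.sqrt (2 * k / (k + 1)) := by
  classical
  have hk' : (1 : ℝ) ≤ k := by exact_mod_cast hk
  have hone : 1 ≤ 2 * (k : ℝ) / (k + 1) := by
    rw [le_div_iff₀ (by positivity)]
    linarith
  rcases le_total l 1 with hl1 | hl1
  · exact hl1.trans (Real.one_le_sqrt.2 hone)
  refine Real.le_sqrt_of_sq_le ?_
  set m : κ → ℝ := fun i => w i * r i with hm
  have hmpos : ∀ i, 0 < m i := fun i => mul_pos (hw i) (hr i)
  have hinner : ∀ i j, -((2 - l ^ 2) * (r i * r j)) ≤ ⟪p i, p j⟫ := by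
    intro i j
    have h1 : ‖p i - p j‖ ^ 2 ≤ (r i + r j) ^ 2 :=
      pow_le_pow_left₀ (norm_nonneg _) (hp i j) 2
    rw [norm_sub_sq_real, hl, hl] at h1
    nlinarith [mul_nonneg (show (0 : ℝ) ≤ l ^ 2 - 1 by nlinarith) (sq_nonneg (r i - r j))]
  -- On the diagonal this is an equality, since `l ^ 2 = 2 - (2 - l ^ 2)`; the extra `2 * m i ^ 2`
  -- is what makes the bound depend on `k`.
  have hterm : ∀ i j, (if i = j then 2 * m i ^ 2 else 0) - (2 - l ^ 2) * (m i * m j)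
      ≤ w i * w j * ⟪p i, p j⟫ := by
    intro i j
    split_ifs with hij
    · subst hij
      rw [real_inner_self_eq_norm_sq, hl]
      simp only [hm]
      apply le_of_eq
      ring
    · have := mul_le_mul_of_nonneg_left (hinner i j) (mul_pos (hw i) (hw j)).le
      simp only [hm]
      calc _ = w i * w j * -((2 - l ^ 2) * (r i * r j)) := by ring
        _ ≤ _ := this
  have hsum : ∑ i, ∑ j, w i * w j * ⟪p i, p j⟫ = 0 := by
    have : ⟪∑ i, w i • p i, ∑ j, w j • p j⟫ = 0 := by rw [h0, inner_zero_left]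
    rw [sum_inner] at this
    rw [← this]
    refine Finset.sum_congr rfl fun i _ => ?_
    rw [inner_sum]
    refine Finset.sum_congr rfl fun j _ => ?_
    rw [inner_smul_left, inner_smul_right]
    simp [mul_assoc]
  have hle : 2 * ∑ i, m i ^ 2 ≤ (2 - l ^ 2) * (∑ i, m i) ^ 2 := by
    have h1 := Finset.sum_le_sum fun i (_ : i ∈ Finset.univ) =>
      Finset.sum_le_sum fun j (_ : j ∈ Finset.univ) => hterm i j
    rw [hsum] at h1
    simp only [Finset.sum_sub_distrib, Finset.sum_ite_eq, Finset.mem_univ, if_true,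
      ← Finset.mul_sum, ← Finset.sum_mul] at h1
    nlinarith
  have hcs : (∑ i, m i) ^ 2 ≤ (k + 1) * ∑ i, m i ^ 2 := by
    have h1 := sq_sum_le_card_mul_sum_sq (s := Finset.univ) (f := m)
    have h2 : ((Finset.univ : Finset κ).card : ℝ) ≤ k + 1 := by
      rw [Finset.card_univ]
      exact_mod_cast hcard
    exact h1.trans (mul_le_mul_of_nonneg_right h2 (Finset.sum_nonneg fun i _ => sq_nonneg _))
  have hSpos : 0 < ∑ i, m i ^ 2 :=
    Finset.sum_pos (fun i _ => pow_pos (hmpos i) 2) Finset.univ_nonempty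
  have hsq : 0 < (∑ i, m i) ^ 2 :=
    pow_pos (Finset.sum_pos (fun i _ => hmpos i) Finset.univ_nonempty) 2
  have hb : 0 ≤ 2 - l ^ 2 := by
    by_contra hneg
    push Not at hneg
    nlinarith [mul_neg_of_neg_of_pos hneg hsq]
  have hfin : 2 ≤ (2 - l ^ 2) * (k + 1) := by
    by_contra hneg
    push Not at hneg
    nlinarith [mul_le_mul_of_nonneg_left hcs hb, mul_lt_mul_of_pos_right hneg hSpos]
  rw [le_div_iff₀ (by positivity)]
  nlinarith

/-- Pairwise intersecting balls (at most `k + 1`, or any finite number in dimension at most `k`)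
acquire a common point when their radii are multiplied by `√(2 k / (k + 1))`. -/
theorem exists_forall_dist_le_sqrt_mul [FiniteDimensional ℝ E] {ι : Type*} [Fintype ι]
    [Nonempty ι] (c : ι → E) (r : ι → ℝ) (hr : ∀ i, 0 < r i)
    (hcr : ∀ i j, dist (c i) (c j) ≤ r i + r j) {k : ℕ} (hk : 1 ≤ k)
    (hcard : min (Module.finrank ℝ E + 1) (Fintype.card ι) ≤ k + 1) :
    ∃ y, ∀ i, dist y (c i) ≤ Real.sqrt (2 * k / (k + 1)) * r i := by
  classical
  let F : E → ℝ := fun y => Finset.univ.sup' Finset.univ_nonempty fun i => dist y (c i) / r i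
  have hcont : Continuous F :=
    Continuous.finset_sup'_apply _ fun i _ => by fun_prop
  have htend : Filter.Tendsto F (Filter.cocompact E) Filter.atTop := by
    obtain ⟨i₀⟩ := ‹Nonempty ι›
    refine Filter.tendsto_atTop_mono (fun y => Finset.le_sup' (fun i => dist y (c i) / r i)
      (Finset.mem_univ i₀)) ?_
    exact (tendsto_dist_right_cocompact_atTop (c i₀)).atTop_div_const (hr i₀)
  obtain ⟨y, hy⟩ := hcont.exists_forall_le htend
  have hyle : ∀ i, dist y (c i) ≤ F y * r i := fun i =>
    (div_le_iff₀ (hr i)).1 (Finset.le_sup' (fun i => dist y (c i) / r i) (Finset.mem_univ i))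
  have hmem := mem_convexHull_active Finset.univ c (fun i => F y * r i) y (fun i _ => hyle i)
    fun y' => by
      obtain ⟨i, hi, he⟩ := Finset.exists_mem_eq_sup' Finset.univ_nonempty
        fun i => dist y' (c i) / r i
      refine ⟨i, hi, (le_div_iff₀ (hr i)).1 ?_⟩
      rw [← he]
      exact hy y'
  -- Carathéodory: affine independence bounds the number of points by the dimension plus one, and
  -- injectivity of `σ` bounds it by the number of balls.
  obtain ⟨κ, _, z, w, hz, hind, hw, hw1, hsum⟩ := eq_pos_convex_span_of_mem_convexHull hmem
  have hne : Nonempty κ := by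
    by_contra hcon
    rw [not_nonempty_iff] at hcon
    simp at hw1
  choose σ hσ hσz using fun a => hz (Set.mem_range_self a)
  have hbound : F y ≤ Real.sqrt (2 * k / (k + 1)) := by
    refine le_sqrt_of_sum_smul_eq_zero (fun a => z a - y) w (fun a => r (σ a)) hw
      (fun a => hr _) ?_ (fun a => ?_) (fun a b => ?_) hk ?_
    · simp [smul_sub, Finset.sum_sub_distrib, ← Finset.sum_smul, hw1, hsum]
    · rw [← hσz, ← dist_eq_norm, dist_comm]
      exact (hσ a).2
    · rw [sub_sub_sub_cancel_right, ← hσz, ← hσz, ← dist_eq_norm]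
      exact hcr _ _
    · refine le_trans (le_min ?_ ?_) hcard
      · refine hind.card_le_finrank_succ.trans ?_
        gcongr
        exact Submodule.finrank_le _
      · refine Fintype.card_le_of_injective σ fun a b hab => hind.injective ?_
        rw [← hσz, ← hσz, hab]
  exact ⟨y, fun i => (hyle i).trans (mul_le_mul_of_nonneg_right hbound (hr i).le)⟩

end Geometry

/-! ### Minimum enclosing balls and the reduction to sets of the minimal size. -/

section MinimumEnclosingBall

open scoped RealInnerProductSpace

variable {d n : ℕ}

/-- An enclosing ball whose centre is a convex combination of points on its boundary is minimal. -/
theorem isMEB_of_mem_convexHull {S : Set (EuclideanSpace ℝ (Fin d))}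
    {z : EuclideanSpace ℝ (Fin d)} {r : ℝ} (hS : S ⊆ Metric.closedBall z r)
    (hz : z ∈ convexHull ℝ (S ∩ Metric.sphere z r)) : IsMEB S z r := by
  refine ⟨hS, fun z' r' h => ?_⟩
  obtain ⟨p, ⟨hpS, hpz⟩, hp⟩ := exists_inner_sub_nonpos hz (z' - z)
  have h1 : ‖p - z'‖ ≤ r' := by simpa [dist_eq_norm] using h hpS
  have h2 : ‖p - z‖ = r := by simpa [dist_eq_norm] using hpz
  refine le_trans ?_ h1
  rw [← h2]
  refine le_of_sq_le_sq ?_ (norm_nonneg _)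
  have e : p - z' = (p - z) - (z' - z) := by abel
  rw [e, norm_sub_sq_real (p - z) (z' - z), real_inner_comm (z' - z) (p - z)]
  nlinarith [sq_nonneg ‖z' - z‖]

/-- Otherwise the centre could be moved closer to all boundary points at once, giving a smaller
ball. -/
theorem IsMEB.mem_convexHull {ι : Type*} {v : ι → EuclideanSpace ℝ (Fin d)} {T : Finset ι}
    (hT : T.Nonempty) {z : EuclideanSpace ℝ (Fin d)} {r : ℝ}
    (h : IsMEB (v '' (T : Set ι)) z r) :
    z ∈ convexHull ℝ (v '' {i | i ∈ T ∧ dist z (v i) = r}) := by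
  refine mem_convexHull_active T v (fun _ => r) z (fun i hi => ?_) fun y' => ?_
  · rw [dist_comm]
    exact h.1 ⟨i, hi, rfl⟩
  · obtain ⟨i, hi, hmax⟩ := T.exists_max_image (fun i => dist y' (v i)) hT
    refine ⟨i, hi, h.2 y' _ ?_⟩
    rintro _ ⟨j, hj, rfl⟩
    rw [Metric.mem_closedBall, dist_comm]
    exact hmax j hj

theorem IsMEB.radius_nonneg {S : Set (EuclideanSpace ℝ (Fin d))} (hne : S.Nonempty)
    {z : EuclideanSpace ℝ (Fin d)} {r : ℝ} (h : IsMEB S z r) : 0 ≤ r :=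
  dist_nonneg.trans (h.1 hne.choose_spec)

/-- The centre of the minimum enclosing ball of points on a sphere around `z` is the point of their
convex hull nearest to `z`. -/
theorem IsMEB.sq_norm_sub_le_inner {ι : Type*} {v : ι → EuclideanSpace ℝ (Fin d)} {T : Finset ι}
    (hT : T.Nonempty) {z c : EuclideanSpace ℝ (Fin d)} {r R : ℝ}
    (h : IsMEB (v '' (T : Set ι)) c r) (hR : ∀ i ∈ T, dist (v i) z = R) :
    ∀ i ∈ T, ‖c - z‖ ^ 2 ≤ ⟪v i - z, c - z⟫ := by
  have hexp : ∀ i ∈ T,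
      ‖v i - c‖ ^ 2 = R ^ 2 - 2 * ⟪v i - z, c - z⟫ + ‖c - z‖ ^ 2 := fun i hi => by
    have e : v i - c = (v i - z) - (c - z) := by abel
    rw [e, norm_sub_sq_real, ← dist_eq_norm (v i), hR i hi]
  obtain ⟨_, ⟨j, ⟨hj, hjr⟩, rfl⟩, hjle⟩ := exists_inner_sub_nonpos (h.mem_convexHull hT) (c - z)
  have hj1 : ‖v j - c‖ = r := by rw [← hjr, dist_comm, dist_eq_norm]
  have hj2 : ⟪v j - z, c - z⟫ ≤ ‖c - z‖ ^ 2 := by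
    have e : v j - c = (v j - z) - (c - z) := by abel
    rw [e, inner_sub_right, real_inner_self_eq_norm_sq, real_inner_comm] at hjle
    linarith
  -- By `hexp`, points farther from `c` have smaller inner product with `c - z`, so the bound at one
  -- point `v l` on the boundary of the minimal ball suffices.
  obtain ⟨_, ⟨l, ⟨hl, hlr⟩, rfl⟩, hlle⟩ := exists_inner_sub_nonpos (h.mem_convexHull hT) (z - c)
  have hl1 : ‖v l - c‖ = r := by rw [← hlr, dist_comm, dist_eq_norm]
  have hl2 : ‖c - z‖ ^ 2 ≤ ⟪v l - z, c - z⟫ := by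
    have e : v l - c = (v l - z) - (c - z) := by abel
    rw [e, ← neg_sub c z, inner_neg_left, inner_sub_right, real_inner_self_eq_norm_sq,
      real_inner_comm] at hlle
    linarith
  intro i hi
  have h1 : ‖v i - c‖ ≤ r := by
    have := h.1 ⟨i, hi, rfl⟩
    rwa [Metric.mem_closedBall, dist_eq_norm] at this
  have h2 : ‖v i - c‖ ^ 2 ≤ r ^ 2 := pow_le_pow_left₀ (norm_nonneg _) h1 2
  have h3 := hexp l hl
  rw [hexp i hi] at h2
  rw [hl1] at h3
  linarith

theorem mebRadius_nonneg (v : Fin n → EuclideanSpace ℝ (Fin d)) {T : Finset (Fin n)}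
    (hT : T.Nonempty) : 0 ≤ mebRadius v T :=
  (isMEB_mebCenter_mebRadius v hT).radius_nonneg ((Finset.coe_nonempty.2 hT).image v)

theorem IsMEB.mebCenter_eq {v : Fin n → EuclideanSpace ℝ (Fin d)} {T : Finset (Fin n)}
    (hT : T.Nonempty) {z : EuclideanSpace ℝ (Fin d)} {r : ℝ}
    (h : IsMEB (v '' (T : Set (Fin n))) z r) : mebCenter v T = z ∧ mebRadius v T = r :=
  (isMEB_mebCenter_mebRadius v hT).unique ((Finset.coe_nonempty.2 hT).image v) h

theorem dist_mebCenter_le (v : Fin n → EuclideanSpace ℝ (Fin d)) {T : Finset (Fin n)}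
    {i : Fin n} (hi : i ∈ T) : dist (v i) (mebCenter v T) ≤ mebRadius v T :=
  (isMEB_mebCenter_mebRadius v ⟨i, hi⟩).1 ⟨i, hi, rfl⟩

theorem mebRadius_mono (v : Fin n → EuclideanSpace ℝ (Fin d)) {T H : Finset (Fin n)}
    (hT : T.Nonempty) (hTH : T ⊆ H) : mebRadius v T ≤ mebRadius v H := by
  refine (isMEB_mebCenter_mebRadius v hT).2 (mebCenter v H) _ ?_
  rintro _ ⟨i, hi, rfl⟩
  exact dist_mebCenter_le v (hTH hi)

/-- For every point `y` some `i ∈ H` can be removed without moving the centre of the minimum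
enclosing ball towards `y`. -/
theorem exists_inner_mebCenter_erase_nonpos (v : Fin n → EuclideanSpace ℝ (Fin d))
    {H : Finset (Fin n)} (hH : 1 < H.card) (y : EuclideanSpace ℝ (Fin d)) :
    ∃ i ∈ H, ⟪y, mebCenter v (H.erase i) - mebCenter v H⟫ ≤ 0 := by
  have hne : H.Nonempty := Finset.card_pos.1 (by omega)
  have hene : ∀ i ∈ H, (H.erase i).Nonempty := fun i hi => by
    rw [← Finset.card_pos, Finset.card_erase_of_mem hi]
    omega
  have hmeb := isMEB_mebCenter_mebRadius v hne
  obtain ⟨κ, _, z, w, hz, hind, hw, hw1, hsum⟩ :=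
    eq_pos_convex_span_of_mem_convexHull (hmeb.mem_convexHull hne)
  have hκ : Nonempty κ := by
    by_contra hcon
    rw [not_nonempty_iff] at hcon
    simp at hw1
  choose σ hσ hσz using fun a => hz (Set.mem_range_self a)
  -- An index not needed to represent the centre can be dropped without changing the ball. If all
  -- are needed, all points lie on the sphere, and the index to drop is the one missing from the
  -- cone containing the projection of `-y`.
  by_cases hsurj : ∀ i ∈ H, ∃ a, σ a = i
  · have hsphere : ∀ i ∈ H, dist (v i) (mebCenter v H) = mebRadius v H := fun i hi => by
      obtain ⟨a, rfl⟩ := hsurj i hi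
      rw [dist_comm]
      exact (hσ a).2
    obtain ⟨k₀, a, ha, ha0, hy⟩ := exists_cone_facet (fun k => z k - mebCenter v H) w hw
      (by simp [smul_sub, Finset.sum_sub_distrib, ← Finset.sum_smul, hw1, hsum]) y
    have hi₀ : σ k₀ ∈ H := (hσ k₀).1
    refine ⟨σ k₀, hi₀, ?_⟩
    set T := H.erase (σ k₀) with hT
    have hmebT := isMEB_mebCenter_mebRadius v (hene _ hi₀)
    have hspan : mebCenter v T - mebCenter v H
        ∈ Submodule.span ℝ (Set.range fun k => z k - mebCenter v H) := by
      set K := Submodule.span ℝ (Set.range fun k => z k - mebCenter v H) with hK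
      have hconv : Convex ℝ {x | x - mebCenter v H ∈ K} := by
        intro x hx x' hx' s t _ _ hst
        have e : s • x + t • x' - mebCenter v H
            = s • (x - mebCenter v H) + t • (x' - mebCenter v H) := by
          rw [smul_sub, smul_sub, sub_add_sub_comm, ← add_smul, hst, one_smul]
        change s • x + t • x' - mebCenter v H ∈ K
        rw [e]
        exact K.add_mem (K.smul_mem s hx) (K.smul_mem t hx')
      refine convexHull_min ?_ hconv (hmebT.mem_convexHull (hene _ hi₀))
      rintro _ ⟨i, ⟨hi, _⟩, rfl⟩
      obtain ⟨b, rfl⟩ := hsurj i (Finset.mem_of_mem_erase hi)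
      exact Submodule.subset_span ⟨b, by simp only [hσz]⟩
    rw [hy _ hspan, neg_nonpos]
    refine Finset.sum_nonneg fun k _ => ?_
    rcases eq_or_ne k k₀ with rfl | hk
    · rw [ha0, zero_mul]
    · refine mul_nonneg (ha k) ?_
      have hkT : σ k ∈ T := by
        refine Finset.mem_erase.2 ⟨fun he => hk (hind.injective ?_), (hσ k).1⟩
        rw [← hσz, ← hσz, he]
      have := hmebT.sq_norm_sub_le_inner (hene _ hi₀)
        (fun i hi => hsphere i (Finset.mem_of_mem_erase hi)) _ hkT
      rw [hσz] at this
      exact (sq_nonneg _).trans this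
  · push Not at hsurj
    obtain ⟨i, hi, hiσ⟩ := hsurj
    refine ⟨i, hi, ?_⟩
    have hT : IsMEB (v '' (H.erase i : Finset (Fin n))) (mebCenter v H) (mebRadius v H) := by
      refine isMEB_of_mem_convexHull (subset_trans (Set.image_mono ?_) hmeb.1) ?_
      · exact_mod_cast Finset.erase_subset i H
      · refine mem_convexHull_of_exists_fintype w z (fun a => (hw a).le) hw1 (fun a => ?_) hsum
        rw [← hσz]
        refine ⟨⟨σ a, Finset.mem_erase.2 ⟨hiσ a, (hσ a).1⟩, rfl⟩, ?_⟩
        rw [Metric.mem_sphere, dist_comm]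
        exact (hσ a).2
    rw [(hT.mebCenter_eq (hene i hi)).1, sub_self, inner_zero_right]

/-- For a suitable `i` the nonpositive inner product gives `‖y - c_H‖ ≤ ‖y - c_T‖` with `T = H.erase
i`, and `r_T ≤ r_H`. -/
theorem norm_sub_mebCenter_le_of_erase (v : Fin n → EuclideanSpace ℝ (Fin d))
    {H : Finset (Fin n)} (hH : 1 < H.card) (y : EuclideanSpace ℝ (Fin d)) {c : ℝ} (hc : 0 ≤ c)
    (h : ∀ i ∈ H, ‖y - mebCenter v (H.erase i)‖ ≤ c * mebRadius v (H.erase i)) :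
    ‖y - mebCenter v H‖ ≤ c * mebRadius v H := by
  obtain ⟨i, hi, hle⟩ := exists_inner_mebCenter_erase_nonpos v hH (y - mebCenter v H)
  have hne : (H.erase i).Nonempty := by
    rw [← Finset.card_pos, Finset.card_erase_of_mem hi]
    omega
  refine le_trans ?_ ((h i hi).trans
    (mul_le_mul_of_nonneg_left (mebRadius_mono v hne (Finset.erase_subset i H)) hc))
  refine le_of_sq_le_sq ?_ (norm_nonneg _)
  have e : y - mebCenter v (H.erase i)
      = (y - mebCenter v H) - (mebCenter v (H.erase i) - mebCenter v H) := by abel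
  rw [e, norm_sub_sq_real (y - mebCenter v H)]
  nlinarith [sq_nonneg ‖mebCenter v (H.erase i) - mebCenter v H‖]

/-- It suffices to check validity on the sets with exactly `m` elements. -/
theorem norm_sub_mebCenter_le_of_card_le (v : Fin n → EuclideanSpace ℝ (Fin d)) {m : ℕ}
    (hm : 1 ≤ m) (y : EuclideanSpace ℝ (Fin d)) {c : ℝ} (hc : 0 ≤ c)
    (h : ∀ T : Finset (Fin n), T.card = m → ‖y - mebCenter v T‖ ≤ c * mebRadius v T)
    (H : Finset (Fin n)) (hH : m ≤ H.card) : ‖y - mebCenter v H‖ ≤ c * mebRadius v H := by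
  obtain ⟨N, hN⟩ : ∃ N, H.card = N := ⟨_, rfl⟩
  rw [hN] at hH
  induction N, hH using Nat.le_induction generalizing H with
  | base => exact h H hN
  | succ N hmN ih =>
    refine norm_sub_mebCenter_le_of_erase v (by omega) y hc fun i hi => ih _ ?_
    rw [Finset.card_erase_of_mem hi, hN, Nat.add_sub_cancel]

end MinimumEnclosingBall

/-! ### The optimal factor and the MinMax-MEB rule. -/

section MinMax

variable {d n t : ℕ}

theorem soddyBound_eq_sqrt (k : ℕ) : soddyBound k = Real.sqrt (2 * k / (k + 1)) := by
  have hk : (0 : ℝ) ≤ k := k.cast_nonneg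
  have h1 : (0 : ℝ) < k + 1 := by positivity
  have hs := Real.sq_sqrt (show (0 : ℝ) ≤ 2 * ((k : ℝ) + 1) * k by positivity)
  have hs0 := Real.sqrt_nonneg (2 * ((k : ℝ) + 1) * k)
  have e : 2 * (k : ℝ) / (k + 1) = (Real.sqrt (2 * ((k : ℝ) + 1) * k) / (k + 1)) ^ 2 := by
    rw [div_pow, hs]
    field_simp
  rw [e, Real.sqrt_sq (by positivity), soddyBound]
  set s := Real.sqrt (2 * ((k : ℝ) + 1) * k)
  have h2 : (0 : ℝ) < k + 1 + s := by positivity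
  rw [eq_div_iff h1.ne', ← sub_eq_zero]
  field_simp
  nlinarith

theorem soddyBound_nonneg (k : ℕ) : 0 ≤ soddyBound k := by
  rw [soddyBound_eq_sqrt]
  exact Real.sqrt_nonneg _

theorem one_le_soddyBound {k : ℕ} (hk : 1 ≤ k) : 1 ≤ soddyBound k := by
  have hk' : (1 : ℝ) ≤ k := by exact_mod_cast hk
  rw [soddyBound_eq_sqrt, Real.one_le_sqrt, le_div_iff₀ (by positivity)]
  linarith

theorem soddyBound_lt_sqrt_two (k : ℕ) : soddyBound k < Real.sqrt 2 := by
  rw [soddyBound_eq_sqrt]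
  refine Real.sqrt_lt_sqrt (by positivity) ?_
  rw [div_lt_iff₀ (by positivity)]
  linarith

theorem nonempty_of_card_eq_sub (hn : 2 * t < n) {T : Finset (Fin n)} (hT : T.card = n - t) :
    T.Nonempty := by
  rw [← Finset.card_pos]
  omega

theorem exists_card_eq_sub (n t : ℕ) : ∃ T : Finset (Fin n), T.card = n - t := by
  obtain ⟨T, -, hT⟩ := Finset.exists_subset_card_eq (s := (Finset.univ : Finset (Fin n)))
    (n := n - t) (by simp)
  exact ⟨T, hT⟩

theorem dist_mebCenter_mebCenter_le (hn : 2 * t < n) (v : Fin n → EuclideanSpace ℝ (Fin d))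
    {T T' : Finset (Fin n)} (hT : T.card = n - t) (hT' : T'.card = n - t) :
    dist (mebCenter v T) (mebCenter v T') ≤ mebRadius v T + mebRadius v T' := by
  have h1 := Finset.card_union_add_card_inter T T'
  have h2 : (T ∪ T').card ≤ n := by simpa using Finset.card_le_univ (T ∪ T')
  obtain ⟨i, hi⟩ : (T ∩ T').Nonempty := by
    rw [← Finset.card_pos]
    omega
  rw [Finset.mem_inter] at hi
  refine (dist_triangle_left _ _ (v i)).trans (add_le_add ?_ ?_)
  · exact dist_mebCenter_le v hi.1
  · exact dist_mebCenter_le v hi.2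

theorem exists_norm_sub_mebCenter_le_soddyBound (hn : 2 * t < n)
    (v : Fin n → EuclideanSpace ℝ (Fin d)) :
    ∃ y, ∀ T : Finset (Fin n), T.card = n - t →
      ‖y - mebCenter v T‖ ≤ soddyBound (effDim d n t) * mebRadius v T := by
  have hrhs : ∀ T : Finset (Fin n), T.card = n - t →
      0 ≤ soddyBound (effDim d n t) * mebRadius v T := fun T hT =>
    mul_nonneg (soddyBound_nonneg _) (mebRadius_nonneg v (nonempty_of_card_eq_sub hn hT))
  have hcard : Fintype.card {T : Finset (Fin n) // T.card = n - t} = n.choose (n - t) := by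
    rw [Fintype.card_finset_len, Fintype.card_fin]
  obtain ⟨T₀, hT₀⟩ := exists_card_eq_sub n t
  -- The bound is `0` for `k = 0`, so all centres must coincide: the space is a point or there is
  -- only one `T`.
  rcases Nat.eq_zero_or_pos (effDim d n t) with hk | hk
  · refine ⟨mebCenter v T₀, fun T hT => ?_⟩
    suffices h : mebCenter v T₀ = mebCenter v T by
      rw [h, sub_self, norm_zero]
      exact hrhs T hT
    rw [effDim, Nat.min_eq_zero_iff] at hk
    rcases hk with rfl | hk
    · exact Subsingleton.elim _ _
    · have hsub : Fintype.card {T : Finset (Fin n) // T.card = n - t} ≤ 1 := by omega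
      have := Fintype.card_le_one_iff.1 hsub ⟨T₀, hT₀⟩ ⟨T, hT⟩
      rw [Subtype.mk.injEq] at this
      rw [this]
  -- The Jung argument divides by the radii. A ball of radius `0` is a point lying in all the other
  -- balls, so factor `1` already suffices there.
  · by_cases hz : ∃ T : Finset (Fin n), T.card = n - t ∧ mebRadius v T = 0
    · obtain ⟨T₁, hT₁, hr⟩ := hz
      refine ⟨mebCenter v T₁, fun T hT => ?_⟩
      have h1 := dist_mebCenter_mebCenter_le hn v hT₁ hT
      rw [hr, zero_add, dist_eq_norm] at h1
      exact h1.trans (le_mul_of_one_le_left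
        (mebRadius_nonneg v (nonempty_of_card_eq_sub hn hT)) (one_le_soddyBound hk))
    · push Not at hz
      have : Nonempty {T : Finset (Fin n) // T.card = n - t} := ⟨⟨T₀, hT₀⟩⟩
      obtain ⟨y, hy⟩ := exists_forall_dist_le_sqrt_mul
        (fun T : {T : Finset (Fin n) // T.card = n - t} => mebCenter v T.1)
        (fun T => mebRadius v T.1)
        (fun T => (mebRadius_nonneg v (nonempty_of_card_eq_sub hn T.2)).lt_of_ne'
          (hz T.1 T.2))
        (fun T T' => dist_mebCenter_mebCenter_le hn v T.2 T'.2) hk (by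
          rw [hcard, finrank_euclideanSpace_fin, effDim]
          omega)
      refine ⟨y, fun T hT => ?_⟩
      rw [soddyBound_eq_sqrt, ← dist_eq_norm]
      exact hy ⟨T, hT⟩

/-- A factor is achievable as soon as every input admits a suitable output. -/
theorem mem_achievableFactors_of_forall_exists (hn : 2 * t < n) {c : ℝ} (hc : 0 ≤ c)
    (h : ∀ v : Fin n → EuclideanSpace ℝ (Fin d), ∃ y, ∀ T : Finset (Fin n), T.card = n - t →
      ‖y - mebCenter v T‖ ≤ c * mebRadius v T) : c ∈ achievableFactors d n t := by
  choose A hA using h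
  exact ⟨hc, A, fun v => norm_sub_mebCenter_le_of_card_le v (by omega) (A v) hc (hA v)⟩

theorem soddyBound_mem_achievableFactors (hn : 2 * t < n) :
    soddyBound (effDim d n t) ∈ achievableFactors d n t :=
  mem_achievableFactors_of_forall_exists hn (soddyBound_nonneg _)
    (exists_norm_sub_mebCenter_le_soddyBound hn)

theorem bddBelow_achievableFactors : BddBelow (achievableFactors d n t) :=
  ⟨0, fun _ hc => hc.1⟩

/-- For fixed `v`, outputs of rules with factors decreasing to the infimum stay in one compact ball;
a limit point satisfies all the limiting inequalities. -/
theorem optimalFactor_mem_achievableFactors (hn : 2 * t < n) :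
    optimalFactor d n t ∈ achievableFactors d n t := by
  have hne : (achievableFactors d n t).Nonempty := ⟨_, soddyBound_mem_achievableFactors hn⟩
  obtain ⟨u, hanti, hlim, hu⟩ := exists_seq_tendsto_sInf hne bddBelow_achievableFactors
  refine mem_achievableFactors_of_forall_exists hn (le_csInf hne fun _ hc => hc.1) fun v => ?_
  choose A hA using fun m => (hu m).2
  obtain ⟨T₀, hT₀⟩ := exists_card_eq_sub n t
  have hmem : ∀ m, A m v ∈ Metric.closedBall (mebCenter v T₀) (u 0 * mebRadius v T₀) :=
    fun m => by
      rw [Metric.mem_closedBall, dist_eq_norm]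
      exact (hA m v T₀ hT₀.ge).trans (mul_le_mul_of_nonneg_right (hanti (Nat.zero_le m))
        (mebRadius_nonneg v (nonempty_of_card_eq_sub hn hT₀)))
  obtain ⟨y, -, φ, hφ, hy⟩ := (isCompact_closedBall _ _).tendsto_subseq hmem
  refine ⟨y, fun T hT => ?_⟩
  refine le_of_tendsto_of_tendsto' (hy.sub_const (mebCenter v T)).norm
    ((hlim.comp hφ.tendsto_atTop).mul_const (mebRadius v T)) fun m => ?_
  exact hA (φ m) v T hT.ge

theorem isLeast_optimalFactor (hn : 2 * t < n) :
    IsLeast (achievableFactors d n t) (optimalFactor d n t) :=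
  ⟨optimalFactor_mem_achievableFactors hn, fun _ hc => csInf_le bddBelow_achievableFactors hc⟩

/-- The truncation at `0` does not distinguish points inside the ball, whence `1 ≤ c`; this is the
source of the maximum with `1` in the theorem. -/
theorem relExcess_le_iff {v : Fin n → EuclideanSpace ℝ (Fin d)} {T : Finset (Fin n)}
    (hr : 0 < mebRadius v T) {y : EuclideanSpace ℝ (Fin d)} {c : ℝ} (hc : 1 ≤ c) :
    relExcess v T y ≤ c - 1 ↔ ‖y - mebCenter v T‖ ≤ c * mebRadius v T := by
  rw [relExcess, div_le_iff₀ hr, max_le_iff, sub_one_mul, sub_le_sub_iff_right]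
  refine and_iff_right_of_imp fun _ => ?_
  nlinarith

theorem relExcess_le_maxRelExcess (v : Fin n → EuclideanSpace ℝ (Fin d)) {T : Finset (Fin n)}
    (hT : T.card = n - t) (y : EuclideanSpace ℝ (Fin d)) :
    relExcess v T y ≤ maxRelExcess t v y :=
  le_ciSup (f := fun T : {T : Finset (Fin n) // T.card = n - t} => relExcess v T.1 y)
    (Set.finite_range _).bddAbove ⟨T, hT⟩

theorem exists_forall_maxRelExcess_le (hn : 2 * t < n) (v : Fin n → EuclideanSpace ℝ (Fin d))
    (hv : ¬ ∃ T : Finset (Fin n), T.card = n - t ∧ mebRadius v T = 0) :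
    ∃ y, ∀ y', maxRelExcess t v y ≤ maxRelExcess t v y' := by
  push Not at hv
  obtain ⟨T₀, hT₀⟩ := exists_card_eq_sub n t
  have hr₀ : 0 < mebRadius v T₀ :=
    (mebRadius_nonneg v (nonempty_of_card_eq_sub hn hT₀)).lt_of_ne' (hv T₀ hT₀)
  have : Nonempty {T : Finset (Fin n) // T.card = n - t} := ⟨⟨T₀, hT₀⟩⟩
  have hcont : Continuous (maxRelExcess t v) := by
    have e : maxRelExcess t v = fun y => Finset.univ.sup' Finset.univ_nonempty
        fun T : {T : Finset (Fin n) // T.card = n - t} => relExcess v T.1 y := by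
      funext y
      rw [Finset.sup'_univ_eq_ciSup, maxRelExcess]
    rw [e]
    refine Continuous.finset_sup'_apply _ fun T _ => ?_
    unfold relExcess
    fun_prop
  refine hcont.exists_forall_le ?_
  refine Filter.tendsto_atTop_mono
    (f := fun y => (dist y (mebCenter v T₀) + -mebRadius v T₀) / mebRadius v T₀) (fun y => ?_) ?_
  · refine le_trans ?_ (relExcess_le_maxRelExcess v hT₀ y)
    rw [relExcess, dist_eq_norm, ← sub_eq_add_neg]
    gcongr
    exact le_max_right _ _
  · exact (Filter.tendsto_atTop_add_const_right _ _
      (tendsto_dist_right_cocompact_atTop (mebCenter v T₀))).atTop_div_const hr₀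

theorem exists_isMinMaxMEB (hn : 2 * t < n) :
    ∃ A : (Fin n → EuclideanSpace ℝ (Fin d)) → EuclideanSpace ℝ (Fin d), IsMinMaxMEB t A := by
  have h : ∀ v : Fin n → EuclideanSpace ℝ (Fin d), ∃ y : EuclideanSpace ℝ (Fin d),
      ((∃ T : Finset (Fin n), T.card = n - t ∧ mebRadius v T = 0) →
        ∃ T : Finset (Fin n), T.card = n - t ∧ mebRadius v T = 0 ∧ y = mebCenter v T) ∧
      ((¬ ∃ T : Finset (Fin n), T.card = n - t ∧ mebRadius v T = 0) →
        ∀ y', maxRelExcess t v y ≤ maxRelExcess t v y') := fun v => by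
    by_cases hv : ∃ T : Finset (Fin n), T.card = n - t ∧ mebRadius v T = 0
    · obtain ⟨T, hT, hr⟩ := hv
      exact ⟨mebCenter v T, fun _ => ⟨T, hT, hr, rfl⟩, fun hcon => absurd ⟨T, hT, hr⟩ hcon⟩
    · obtain ⟨y, hy⟩ := exists_forall_maxRelExcess_le hn v hv
      exact ⟨y, fun hcon => absurd hcon hv, fun _ => hy⟩
  choose A hA using h
  exact ⟨A, hA⟩

/-- MinMax-MEB is as good as any rule, up to the factor `1`. -/
theorem IsMinMaxMEB.isMEBValid_max_one (hn : 2 * t < n)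
    {A : (Fin n → EuclideanSpace ℝ (Fin d)) → EuclideanSpace ℝ (Fin d)} (hA : IsMinMaxMEB t A)
    {c : ℝ} (hc : c ∈ achievableFactors d n t) : IsMEBValid t (max 1 c) A := by
  intro v
  have hc1 : 1 ≤ max 1 c := le_max_left 1 c
  obtain ⟨-, B, hB⟩ := hc
  refine norm_sub_mebCenter_le_of_card_le v (by omega) (A v) (zero_le_one.trans hc1)
    fun T hT => ?_
  have hrT := mebRadius_nonneg v (nonempty_of_card_eq_sub hn hT)
  have hB' : ∀ T : Finset (Fin n), T.card = n - t →
      ‖B v - mebCenter v T‖ ≤ max 1 c * mebRadius v T := fun T hT =>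
    (hB v T hT.ge).trans (mul_le_mul_of_nonneg_right (le_max_right 1 c)
      (mebRadius_nonneg v (nonempty_of_card_eq_sub hn hT)))
  by_cases hv : ∃ T : Finset (Fin n), T.card = n - t ∧ mebRadius v T = 0
  · obtain ⟨T₁, hT₁, hr, hAv⟩ := (hA v).1 hv
    -- Radius `0` leaves a valid rule no freedom: `B v` must be the centre that MinMax-MEB returns.
    have h1 := hB' T₁ hT₁
    rw [hr, mul_zero, norm_le_zero_iff, sub_eq_zero] at h1
    rw [hAv, ← h1]
    exact hB' T hT
  · have hpos : ∀ T : Finset (Fin n), T.card = n - t → 0 < mebRadius v T := fun T hT =>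
      (mebRadius_nonneg v (nonempty_of_card_eq_sub hn hT)).lt_of_ne'
        fun h => hv ⟨T, hT, h⟩
    have : Nonempty {T : Finset (Fin n) // T.card = n - t} := ⟨⟨T, hT⟩⟩
    rw [← relExcess_le_iff (hpos T hT) hc1]
    refine (relExcess_le_maxRelExcess v hT _).trans (((hA v).2 hv (B v)).trans ?_)
    exact ciSup_le fun T' => (relExcess_le_iff (hpos _ T'.2) hc1).2 (hB' _ T'.2)

theorem isMEB_pair_zero (u : EuclideanSpace ℝ (Fin d)) :
    IsMEB {u, 0} ((1 / 2 : ℝ) • u) (‖u‖ / 2) := by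
  have h1 : dist u ((1 / 2 : ℝ) • u) = ‖u‖ / 2 := by
    have e : u - (1 / 2 : ℝ) • u = (1 / 2 : ℝ) • u := by
      rw [sub_eq_iff_eq_add, ← add_smul]
      norm_num
    rw [dist_eq_norm, e, norm_smul]
    norm_num
    ring
  have h2 : dist 0 ((1 / 2 : ℝ) • u) = ‖u‖ / 2 := by
    rw [dist_eq_norm, zero_sub, norm_neg, norm_smul]
    norm_num
    ring
  refine isMEB_of_mem_convexHull ?_ ?_
  · rintro p (rfl | rfl)
    · exact h1.le
    · exact h2.le
  · have hu : u ∈ ({u, 0} : Set _) ∩ Metric.sphere ((1 / 2 : ℝ) • u) (‖u‖ / 2) :=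
      ⟨Or.inl rfl, h1⟩
    have h0 : 0 ∈ ({u, 0} : Set _) ∩ Metric.sphere ((1 / 2 : ℝ) • u) (‖u‖ / 2) :=
      ⟨Or.inr rfl, h2⟩
    have := (convex_convexHull ℝ _) (subset_convexHull ℝ _ hu) (subset_convexHull ℝ _ h0)
      (show (0 : ℝ) ≤ 1 / 2 by norm_num) (show (0 : ℝ) ≤ 1 / 2 by norm_num) (by norm_num)
    rwa [smul_zero, add_zero] at this

/-- With one possibly Byzantine node, no factor below `1` is achievable: the minimum enclosing
balls of two admissible sets may touch in a single point. -/
theorem one_le_of_mem_achievableFactors (hn : 2 * t < n) (ht : 1 ≤ t) (hd : 1 ≤ d) {c : ℝ}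
    (hc : c ∈ achievableFactors d n t) : 1 ≤ c := by
  obtain ⟨-, A, hA⟩ := hc
  let e : EuclideanSpace ℝ (Fin d) := EuclideanSpace.single ⟨0, hd⟩ 1
  have he : ‖e‖ = 1 := by simp [e]
  let v : Fin n → EuclideanSpace ℝ (Fin d) := fun i =>
    if i.1 = 0 then -e else if i.1 = 1 then e else 0
  have key : ∀ (a b o : Fin n) (u : EuclideanSpace ℝ (Fin d)), a ≠ b → o ≠ a → o ≠ b →
      v a = u → v o = 0 → (∀ i, i ≠ b → v i = u ∨ v i = 0) →
      ‖A v - (1 / 2 : ℝ) • u‖ ≤ c * (‖u‖ / 2) := by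
    intro a b o u hab hoa hob hva hvo hvi
    -- Such a `T` omits `b` because `t ≥ 1`, and has room for `a` and `o` because `n - t ≥ t + 1 ≥
    -- 2`.
    obtain ⟨T, hT1, hT2, hT⟩ := Finset.exists_subsuperset_card_eq (n := n - t)
      (show ({a, o} : Finset (Fin n)) ⊆ Finset.univ.erase b by
        intro i hi
        rw [Finset.mem_insert, Finset.mem_singleton] at hi
        rcases hi with rfl | rfl <;> simp [*])
      (by rw [Finset.card_pair hoa.symm]; omega)
      (by rw [Finset.card_erase_of_mem (Finset.mem_univ b), Finset.card_univ, Fintype.card_fin]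
          omega)
    have himage : v '' (T : Set (Fin n)) = {u, 0} := by
      refine Set.Subset.antisymm ?_ ?_
      · rintro _ ⟨i, hi, rfl⟩
        exact hvi i (Finset.ne_of_mem_erase (hT2 hi))
      · rintro p (rfl | rfl)
        · exact ⟨a, hT1 (by simp), hva⟩
        · exact ⟨o, hT1 (by simp), hvo⟩
    have hmeb : IsMEB (v '' (T : Set (Fin n))) ((1 / 2 : ℝ) • u) (‖u‖ / 2) := by
      rw [himage]
      exact isMEB_pair_zero u
    obtain ⟨h1, h2⟩ := hmeb.mebCenter_eq ⟨a, hT1 (by simp)⟩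
    rw [← h1, ← h2]
    exact hA v T hT.ge
  have k1 := key ⟨0, by omega⟩ ⟨1, by omega⟩ ⟨2, by omega⟩ (-e) (by simp) (by simp) (by simp)
    (by simp [v]) (by simp [v]) fun i hi => by
      rw [Ne, Fin.ext_iff] at hi
      simp only [v, if_neg hi]
      split_ifs <;> simp
  have k2 := key ⟨1, by omega⟩ ⟨0, by omega⟩ ⟨2, by omega⟩ e (by simp) (by simp) (by simp)
    (by simp [v]) (by simp [v]) fun i hi => by
      rw [Ne, Fin.ext_iff] at hi
      simp only [v, if_neg hi]
      split_ifs <;> simp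
  rw [norm_neg, he] at k1
  rw [he] at k2
  -- The centres `± e / 2` are at distance `1` and both radii are `1 / 2`, so `1 ≤ c / 2 + c / 2`.
  have h := norm_sub_le (A v - (1 / 2 : ℝ) • -e) (A v - (1 / 2 : ℝ) • e)
  have e' : A v - (1 / 2 : ℝ) • -e - (A v - (1 / 2 : ℝ) • e) = e := by
    rw [sub_sub_sub_cancel_left, smul_neg, sub_neg_eq_add, ← add_smul]
    norm_num
  rw [e', he] at h
  linarith

end MinMax

theorem mainTheorem1 (d n t : ℕ) (hn : 2 * t < n) :
    IsLeast (achievableFactors d n t) (optimalFactor d n t) ∧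
    optimalFactor d n t ≤ soddyBound (effDim d n t) ∧
    soddyBound (effDim d n t) < Real.sqrt 2 ∧
    (∃ A : (Fin n → EuclideanSpace ℝ (Fin d)) → EuclideanSpace ℝ (Fin d), IsMinMaxMEB t A) ∧
    (∀ A : (Fin n → EuclideanSpace ℝ (Fin d)) → EuclideanSpace ℝ (Fin d), IsMinMaxMEB t A →
      IsMEBValid t (max 1 (optimalFactor d n t)) A ∧
      (1 ≤ t → IsMEBValid t (optimalFactor d n t) A)) := by
  have hopt := optimalFactor_mem_achievableFactors (d := d) hn
  refine ⟨isLeast_optimalFactor hn,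
    (isLeast_optimalFactor hn).2 (soddyBound_mem_achievableFactors hn),
    soddyBound_lt_sqrt_two _, exists_isMinMaxMEB hn, fun A hA => ?_⟩
  have hmax := hA.isMEBValid_max_one hn hopt
  refine ⟨hmax, fun ht => ?_⟩
  -- In dimension `0` the lower bound `1` on factors is not available, but all points coincide.
  rcases Nat.eq_zero_or_pos d with rfl | hd
  · intro v H hH
    rw [Subsingleton.elim (A v) (mebCenter v H), sub_self, norm_zero]
    exact mul_nonneg hopt.1 (mebRadius_nonneg v (Finset.card_pos.1 (by omega)))
  · rwa [max_eq_right (one_le_of_mem_achievableFactors hn ht hd hopt)] at hmax
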